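/- Let $A$ be a finite alphabet. A finite word over $A$ is a factor of a bi-infinite word $w\colon\mathbb Z\to A$ if it occurs in $w$ as a block of consecutive letters; bi-infinite words are considered up to a shift. A finite set $S$ of finite words over $A$ (a system of forbidden words) is said to define $w$ if no word of $S$ is a factor of $w$, and every bi-infinite word over $A$ (periodic or not) none of whose factors belongs to $S$ is a shift of $w$. Let $w$ be a periodic bi-infinite word over $A$ with least positive period $n$, and suppose that $w$ is defined by a system $S$ consisting of exactly $k$ forbidden words. Then $$n\le\varphi_k,$$ where $\varphi_0=\varphi_1=1$ and $\varphi_{k+2}=\varphi_{k+1}+\varphi_k$ are the Fibonacci numbers. In particular, the least period is at most exponential in the number of forbidden words: $n\le\left(\frac{1+\sqrt5}{2}\right)^k$. -/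

import Mathlib

/-- The finite word `l` occurs in the bi-infinite word `w` (a factor of `w`). -/
def IsFactor {A : Type*} (l : List A) (w : ℤ → A) : Prop :=
  ∃ i : ℤ, ∀ j : Fin l.length, w (i + (j : ℤ)) = l.get j

/-- The bi-infinite word `w` satisfies the system `S` of forbidden words:
no word of `S` is a factor of `w`. -/
def Avoids {A : Type*} (S : Finset (List A)) (w : ℤ → A) : Prop :=
  ∀ l ∈ S, ¬ IsFactor l w

/-- Two bi-infinite words are regarded as the same word if one is a shift of the other. -/
def ShiftEquiv {A : Type*} (w w' : ℤ → A) : Prop :=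
  ∃ c : ℤ, ∀ i : ℤ, w' i = w (i + c)

/-- The finite system `S` of forbidden words defines `w`: the word `w` satisfies `S`, and it is,
up to a shift, the only bi-infinite word (periodic or not) over the alphabet that does so. -/
def Determines {A : Type*} (S : Finset (List A)) (w : ℤ → A) : Prop :=
  Avoids S w ∧ ∀ w' : ℤ → A, Avoids S w' → ShiftEquiv w w'

/-- The bi-infinite word `w` is periodic, and `n` is its least positive period. -/
def HasLeastPeriod {A : Type*} (w : ℤ → A) (n : ℕ) : Prop :=
  IsLeast {p : ℕ | 0 < p ∧ Function.Periodic w (p : ℤ)} n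

/-- The Fibonacci numbers numbered from `fibNum 0 = fibNum 1 = 1`. -/
def fibNum : ℕ → ℕ
  | 0 => 1
  | 1 => 1
  | k + 2 => fibNum (k + 1) + fibNum k

/-! The bound holds for every finite `T` avoided by some periodic word: a periodic word of period at
most `fibNum T.card` also avoids `T` (`exists_short_period`). If `T` defines `w`, that word is a
shift of `w`.

Induct on the size. Let `w` have the least period `n` among periodic words avoiding `T`, with `n ≥
2`, and let `m` be the length of a longest block repeated at positions distinct mod `n`. Blocks of
length `m + 1` then fix positions of `w` mod `n`, so forbidden words can be strengthened to length
at most `m + 2` (`exists_short_forbidden`), that is, to restrictions on vertices and edges of the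
graph of `(m + 1)`-blocks. Around the repeated block, `w` uses edges `a₁ → b₁` and `a₂ → b₂`. Either
crossing edge `a₁ → b₂`, `a₂ → b₁` would shortcut `w`, so by minimality both are forbidden.

Drop these two restrictions, leaving `c ≤ k - 2`. Induction gives a closed walk `f` of length at
most `fibNum c`. If `f` uses, say, `a₁ → b₂`, forbid the vertex `a₁` instead: a shortcut of `w`
satisfies this, so induction gives `g` of length at most `fibNum (c + 1)`. Unless `f` or `g` already
works, `exists_glued` exchanges their crossing edges for those of `w`, and the lengths at most add.
-/

/-! ### Closed walks in a directed graph. -/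

section Walks

variable {V : Type*}

/-- There is a walk with `n` steps from `a` to `b` along the relation `r`. -/
def Steps (r : V → V → Prop) : ℕ → V → V → Prop
  | 0, a, b => a = b
  | n + 1, a, b => ∃ c, r a c ∧ Steps r n c b

theorem Steps.trans {r : V → V → Prop} {n m : ℕ} {a b c : V} (h : Steps r n a b)
    (h' : Steps r m b c) : Steps r (n + m) a c := by
  induction n generalizing a with
  | zero => cases h; simpa using h'
  | succ n ih =>
    obtain ⟨d, hd, h⟩ := h
    rw [Nat.add_right_comm]
    exact ⟨d, hd, ih h⟩

theorem Steps.single {r : V → V → Prop} {a b : V} (h : r a b) : Steps r 1 a b :=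
  ⟨b, h, rfl⟩

theorem Steps.mono {r s : V → V → Prop} (h : ∀ a b, r a b → s a b) {n : ℕ} {a b : V}
    (hr : Steps r n a b) : Steps s n a b := by
  induction n generalizing a with
  | zero => exact hr
  | succ n ih =>
    obtain ⟨c, hc, hr⟩ := hr
    exact ⟨c, h _ _ hc, ih hr⟩

theorem Steps.of_seq {r : V → V → Prop} (f : ℤ → V) (i : ℤ) (n : ℕ)
    (h : ∀ t : ℕ, t < n → r (f (i + t)) (f (i + t + 1))) : Steps r n (f i) (f (i + n)) := by
  induction n with
  | zero => simp [Steps]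
  | succ n ih =>
    have h1 := (ih fun t ht => h t (ht.trans n.lt_succ_self)).trans (.single (h n n.lt_succ_self))
    simpa [add_assoc] using h1

theorem Steps.exists_seq {r : V → V → Prop} {n : ℕ} {a b : V} (h : Steps r n a b) :
    ∃ f : ℕ → V, f 0 = a ∧ f n = b ∧ ∀ t < n, r (f t) (f (t + 1)) := by
  induction n generalizing a with
  | zero => exact ⟨fun _ => a, rfl, h, by simp⟩
  | succ n ih =>
    obtain ⟨c, hc, h⟩ := h
    obtain ⟨f, h0, hn, hf⟩ := ih h
    refine ⟨fun t => Nat.casesOn t a f, rfl, hn, ?_⟩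
    rintro (_ | t) ht
    · simpa [h0] using hc
    · exact hf t (by omega)

/-- A closed walk can be traversed periodically. -/
theorem Steps.exists_periodic {r : V → V → Prop} {n : ℕ} {a : V} (hn : 0 < n)
    (h : Steps r n a a) :
    ∃ f : ℤ → V, Function.Periodic f (n : ℤ) ∧ ∀ t, r (f t) (f (t + 1)) := by
  obtain ⟨f, h0, hf, hr⟩ := h.exists_seq
  have hn' : (0 : ℤ) < n := by exact_mod_cast hn
  refine ⟨fun t => f (t % n).toNat, fun t => by simp, fun t => ?_⟩
  have h1 := Int.emod_nonneg t hn'.ne'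
  have h2 := Int.emod_lt_of_pos t hn'
  have h3 := hr (t % n).toNat (by omega)
  have h4 : (t + 1) % n = (t % n + 1) % n := by simp
  dsimp only
  rw [h4]
  rcases eq_or_lt_of_le (show t % n + 1 ≤ n by omega) with h5 | h5
  · rw [h5, Int.emod_self]
    rw [show (t % n).toNat + 1 = n by omega, hf] at h3
    simpa [h0] using h3
  · rw [Int.emod_eq_of_lt (by omega) h5, show (t % n + 1).toNat = (t % n).toNat + 1 by omega]
    exact h3

/-- Following a periodic walk from a marked edge to the next marked edge. -/
theorem exists_steps_to_next {r : V → V → Prop} (bad : V → V → Prop) {f : ℤ → V} {p : ℕ}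
    (hp : 0 < p) (hf : Function.Periodic f (p : ℤ)) (hr : ∀ t, r (f t) (f (t + 1))) {i : ℤ}
    (hi : bad (f i) (f (i + 1))) :
    ∃ (n : ℕ) (j : ℤ), n < p ∧ bad (f j) (f (j + 1)) ∧
      Steps (fun a b => r a b ∧ ¬ bad a b) n (f (i + 1)) (f j) := by
  classical
  have hex : ∃ n : ℕ, bad (f (i + 1 + n)) (f (i + 1 + n + 1)) := by
    -- One full period after `i` the marked edge itself recurs.
    refine ⟨p - 1, ?_⟩
    have e : i + 1 + ((p - 1 : ℕ) : ℤ) = i + p := by omega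
    rw [e, hf, add_right_comm, hf]
    exact hi
  refine ⟨Nat.find hex, _, ?_, Nat.find_spec hex, .of_seq f _ _ fun t ht => ⟨hr _, Nat.find_min hex ht⟩⟩
  have h : Nat.find hex ≤ p - 1 := by
    apply Nat.find_le
    have e : i + 1 + ((p - 1 : ℕ) : ℤ) = i + p := by omega
    rw [e, hf, add_right_comm, hf]
    exact hi
  omega

/-- Two periodic walks, through the edges `a₁ → b₂` and `a₂ → b₁` respectively, are combined
into a closed walk which uses `a₁ → b₁` and `a₂ → b₂` instead. -/
theorem exists_closed_steps_of_cross {r : V → V → Prop} {a₁ a₂ b₁ b₂ : V}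
    {f g : ℤ → V} {p q : ℕ} (hp : 0 < p) (hq : 0 < q)
    (hf : Function.Periodic f (p : ℤ)) (hg : Function.Periodic g (q : ℤ))
    (hrf : ∀ t, r (f t) (f (t + 1))) (hrg : ∀ t, r (g t) (g (t + 1)))
    (hga : ∀ t, g t ≠ a₁) (ha : a₁ ≠ a₂) (hb : b₁ ≠ b₂)
    (h₁ : r a₁ b₁) (h₂ : r a₂ b₂)
    {i j : ℤ} (hi : f i = a₁) (hi' : f (i + 1) = b₂) (hj : g j = a₂) (hj' : g (j + 1) = b₁) :
    ∃ (n : ℕ) (c : V), 0 < n ∧ n ≤ p + q ∧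
      Steps (fun a b => r a b ∧ ¬ (a = a₁ ∧ b = b₂ ∨ a = a₂ ∧ b = b₁)) n c c := by
  obtain ⟨n, i₂, hn, hbad, hs⟩ := exists_steps_to_next
    (fun a b => a = a₁ ∧ b = b₂ ∨ a = a₂ ∧ b = b₁) hp hf hrf (Or.inl ⟨hi, hi'⟩)
  obtain ⟨m, j₂, hm, hbad', hs'⟩ := exists_steps_to_next
    (fun a b => a = a₁ ∧ b = b₂ ∨ a = a₂ ∧ b = b₁) hq hg hrg (Or.inr ⟨hj, hj'⟩)
  have e₁ := Steps.single (r := fun a b => r a b ∧ ¬ (a = a₁ ∧ b = b₂ ∨ a = a₂ ∧ b = b₁))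
    (a := a₁) (b := b₁) ⟨h₁, by simp [ha, hb]⟩
  have e₂ := Steps.single (r := fun a b => r a b ∧ ¬ (a = a₁ ∧ b = b₂ ∨ a = a₂ ∧ b = b₁))
    (a := a₂) (b := b₂) ⟨h₂, by simp [ha.symm, hb.symm]⟩
  rw [hi'] at hs
  -- `g` never visits `a₁`, so its next marked edge starts at `a₂`. The walk `f` may stop at `a₁`,
  -- where the detour along `g` is needed, or at `a₂`, where one edge closes it.
  rw [hj', (hbad'.resolve_left fun h => hga _ h.1).1] at hs'
  rcases hbad with ⟨h, -⟩ | ⟨h, -⟩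
  · rw [h] at hs
    exact ⟨_, _, by omega, by omega, ((hs.trans e₁).trans hs').trans e₂⟩
  · rw [h] at hs
    exact ⟨_, _, by omega, by omega, hs.trans e₂⟩

end Walks

/-! ### Bi-infinite words as walks in the block graph. -/

section Windows

variable {A : Type*}

/-- The word `l` occurs in `w` at position `i`. -/
def OccursAt (l : List A) (w : ℤ → A) (i : ℤ) : Prop :=
  ∀ (j : ℕ) (h : j < l.length), w (i + j) = l[j]

theorem isFactor_iff {l : List A} {w : ℤ → A} : IsFactor l w ↔ ∃ i, OccursAt l w i :=
  exists_congr fun _ => ⟨fun h j hj => h ⟨j, hj⟩, fun h j => h j j.2⟩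

theorem OccursAt.congr {l : List A} {w w' : ℤ → A} {i i' : ℤ} (h : OccursAt l w i)
    (hw : ∀ j : ℕ, j < l.length → w (i + j) = w' (i' + j)) : OccursAt l w' i' :=
  fun j hj => (hw j hj).symm.trans (h j hj)

/-- The block of `N` letters of `w` starting at position `i`. -/
def window (N : ℕ) (w : ℤ → A) (i : ℤ) : Fin N → A := fun j => w (i + (j : ℕ))

theorem window_eq_iff {N : ℕ} {w w' : ℤ → A} {i i' : ℤ} :
    window N w i = window N w' i' ↔ ∀ j : ℕ, j < N → w (i + j) = w' (i' + j) :=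
  ⟨fun h j hj => congrFun h ⟨j, hj⟩, fun h => funext fun j => h j j.2⟩

theorem window_periodic {N : ℕ} {w : ℤ → A} {p : ℤ} (h : Function.Periodic w p) :
    Function.Periodic (window N w) p := fun i => by
  rw [window_eq_iff]
  intro j _
  rw [add_right_comm, h]

theorem occursAt_ofFn_window {N : ℕ} {w w' : ℤ → A} {i i' : ℤ} :
    OccursAt (List.ofFn (window N w i)) w' i' ↔ window N w i = window N w' i' := by
  rw [window_eq_iff]
  simp [OccursAt, window, eq_comm]

theorem window_succ_succ_eq_iff {N : ℕ} {w w' : ℤ → A} {i i' : ℤ} :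
    window (N + 2) w i = window (N + 2) w' i' ↔
      window (N + 1) w i = window (N + 1) w' i' ∧
        window (N + 1) w (i + 1) = window (N + 1) w' (i' + 1) := by
  simp only [window_eq_iff]
  constructor
  · intro h
    refine ⟨fun j hj => h j (by omega), fun j hj => ?_⟩
    have := h (j + 1) (by omega)
    push_cast at this
    rwa [add_assoc, add_assoc, add_comm 1]
  · rintro ⟨h, h'⟩ (_ | j) hj
    · exact h 0 (by omega)
    · have := h' j (by omega)
      push_cast
      rwa [add_assoc, add_assoc, add_comm 1] at this

theorem occursAt_eq_ofFn {N : ℕ} {w : ℤ → A} {i : ℤ} {l : List A} (h : OccursAt l w i)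
    (hl : l.length = N) : l = List.ofFn (window N w i) := by
  apply List.ext_getElem (by simp [hl])
  intro j h₁ _
  simp [window, h j h₁]

/-- The graph on blocks of length `N` whose bi-infinite walks are the bi-infinite words avoiding
`T`, when the words of `T` have length at most `N + 1`. -/
def BlockStep (N : ℕ) (T : Finset (List A)) (a b : Fin N → A) : Prop :=
  ∃ g : ℤ → A, window N g 0 = a ∧ window N g 1 = b ∧ ∀ l ∈ T, ¬ OccursAt l g 0

theorem blockStep_window {N : ℕ} {T : Finset (List A)} {w : ℤ → A} {i : ℤ}
    (h : ∀ l ∈ T, ¬ OccursAt l w i) :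
    BlockStep N T (window N w i) (window N w (i + 1)) :=
  ⟨fun t => w (i + t), by simp [window_eq_iff], by simp [window_eq_iff, add_assoc],
    fun l hl h' => h l hl (h'.congr (by simp))⟩

theorem Avoids.blockStep {N : ℕ} {T : Finset (List A)} {w : ℤ → A} (h : Avoids T w) (i : ℤ) :
    BlockStep N T (window N w i) (window N w (i + 1)) :=
  blockStep_window fun l hl h' => h l hl (isFactor_iff.2 ⟨i, h'⟩)

/-- Consecutive blocks overlap, so letter `j` of block `t` is the first letter of block `t + j`. An
edge therefore spells `N + 2` letters of the word, enough to see every element of `T`. -/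
theorem avoids_of_blockStep {N : ℕ} {T : Finset (List A)}
    (hT : ∀ l ∈ T, l.length ≤ N + 2) {f : ℤ → Fin (N + 1) → A}
    (hf : ∀ t, BlockStep (N + 1) T (f t) (f (t + 1))) :
    Avoids T fun t => f t 0 := by
  have key : ∀ (j : ℕ) (hj : j < N + 1) (t : ℤ), f (t + j) 0 = f t ⟨j, hj⟩ := by
    intro j
    induction j with
    | zero => intro _ t; simp
    | succ j ih =>
      intro hj t
      obtain ⟨g, h0, h1, -⟩ := hf t
      have := ih (by omega) (t + 1)
      rw [← h1] at this
      rw [← h0]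
      push_cast
      rw [add_comm (j : ℤ), ← add_assoc, this]
      simp [window, add_comm]
  intro l hl hfac
  obtain ⟨t, ht⟩ := isFactor_iff.1 hfac
  obtain ⟨g, h0, h1, h⟩ := hf t
  refine h l hl (ht.congr fun j hj => ?_)
  have hjN := hT l hl
  rcases Nat.lt_or_ge j (N + 1) with hj' | hj'
  · rw [key j hj' t, ← h0]; rfl
  · obtain rfl : j = N + 1 := by omega
    have := key N (by omega) (t + 1)
    rw [← h1] at this
    push_cast
    rw [add_comm (N : ℤ), ← add_assoc, this]
    simp [window]

/-- A closed walk in the block graph is a periodic word. -/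
theorem exists_periodic_of_steps {N : ℕ} {T : Finset (List A)}
    (hT : ∀ l ∈ T, l.length ≤ N + 2) {n : ℕ} (hn : 0 < n) {a : Fin (N + 1) → A}
    (h : Steps (BlockStep (N + 1) T) n a a) :
    ∃ w : ℤ → A, Avoids T w ∧ Function.Periodic w (n : ℤ) := by
  obtain ⟨f, hf, hr⟩ := h.exists_periodic hn
  exact ⟨_, avoids_of_blockStep hT hr, fun t => by simp only [hf t]⟩

end Windows

/-! ### Crossing edges at a repeated block. -/

section Crossing

variable {A : Type*}

/-- The word that follows `w` from position `i` for `m + 1` letters, then jumps to position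
`j + m + 1`. -/
def crossing (w : ℤ → A) (m : ℕ) (i j : ℤ) : ℤ → A :=
  fun t => if t ≤ m then w (i + t) else w (j + t)

theorem window_crossing_zero (w : ℤ → A) (m : ℕ) (i j : ℤ) :
    window (m + 1) (crossing w m i j) 0 = window (m + 1) w i := by
  rw [window_eq_iff]
  intro t ht
  simp [crossing, Nat.lt_succ_iff.1 ht]

theorem window_crossing_one {w : ℤ → A} {m : ℕ} {i j : ℤ}
    (hv : window m w (i + 1) = window m w (j + 1)) :
    window (m + 1) (crossing w m i j) 1 = window (m + 1) w (j + 1) := by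
  rw [window_eq_iff] at hv ⊢
  intro t ht
  rcases Nat.lt_succ_iff_lt_or_eq.1 ht with h | rfl
  · rw [crossing, if_pos (by omega), ← add_assoc, hv t h]
  · rw [crossing, if_neg (by omega), add_assoc]

/-- The forbidden word obtained by jumping from the occurrence of a repeated block of length `m`
after position `i` to the one after position `j`. -/
def crossingWord (w : ℤ → A) (m : ℕ) (i j : ℤ) : List A :=
  List.ofFn (window (m + 2) (crossing w m i j) 0)

theorem crossingWord_add_left {w : ℤ → A} {n : ℤ} (hw : Function.Periodic w n) (m : ℕ) (i j : ℤ) :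
    crossingWord w m (i + n) j = crossingWord w m i j := by
  have : crossing w m (i + n) j = crossing w m i j := by
    funext t
    simp only [crossing, add_right_comm i n t, hw (i + t)]
  rw [crossingWord, this, crossingWord]

theorem crossingWord_add_right {w : ℤ → A} {n : ℤ} (hw : Function.Periodic w n) (m : ℕ)
    (i j : ℤ) : crossingWord w m i (j + n) = crossingWord w m i j := by
  have : crossing w m i (j + n) = crossing w m i j := by
    funext t
    simp only [crossing, add_right_comm j n t, hw (j + t)]
  rw [crossingWord, this, crossingWord]

/-- A word of length `m + 2` is a pair of overlapping `(m + 1)`-blocks, so forbidding a crossing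
word deletes exactly one edge. -/
theorem occursAt_crossingWord {w g : ℤ → A} {m : ℕ} {i j t : ℤ}
    (hv : window m w (i + 1) = window m w (j + 1)) :
    OccursAt (crossingWord w m i j) g t ↔
      window (m + 1) g t = window (m + 1) w i ∧ window (m + 1) g (t + 1) = window (m + 1) w (j + 1) := by
  rw [crossingWord, occursAt_ofFn_window, window_succ_succ_eq_iff, window_crossing_zero, zero_add,
    window_crossing_one hv, eq_comm, @eq_comm _ (window (m + 1) w (j + 1))]

theorem blockStep_crossing {w : ℤ → A} {m : ℕ} {i j : ℤ} {T : Finset (List A)}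
    (hv : window m w (i + 1) = window m w (j + 1)) (hT : ∀ l ∈ T, l.length ≤ m + 2)
    (hi : ∀ l ∈ T, ¬ OccursAt l w i) (he : crossingWord w m i j ∉ T) :
    BlockStep (m + 1) T (window (m + 1) w i) (window (m + 1) w (j + 1)) := by
  refine ⟨_, window_crossing_zero w m i j, window_crossing_one hv, fun l hl h => ?_⟩
  rcases (hT l hl).eq_or_lt with h' | h'
  · rw [occursAt_eq_ofFn h h'] at hl
    exact he hl
  · refine hi l hl (h.congr fun t ht => ?_)
    simp [crossing, show t ≤ m by omega]

/-- Cutting `w` at a repeated block gives a shorter periodic word. -/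
theorem exists_shortcut {w : ℤ → A} {m : ℕ} {i j : ℤ} {T : Finset (List A)} (hij : i < j)
    (hv : window m w (i + 1) = window m w (j + 1)) (hT : ∀ l ∈ T, l.length ≤ m + 2)
    (hw : ∀ t, i < t → t ≤ j → ∀ l ∈ T, ¬ OccursAt l w t) (he : crossingWord w m j i ∉ T) :
    ∃ w' : ℤ → A, Avoids T w' ∧ Function.Periodic w' (j - i) := by
  obtain ⟨d, hd⟩ : ∃ d : ℕ, j = i + 1 + d := ⟨(j - i - 1).toNat, by omega⟩
  have h₁ : Steps (BlockStep (m + 1) T) d (window (m + 1) w (i + 1)) (window (m + 1) w j) := by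
    rw [hd]
    exact .of_seq (window (m + 1) w) _ _ fun t ht =>
      blockStep_window (hw _ (by omega) (by omega))
  have h₂ := h₁.trans (.single (blockStep_crossing hv.symm hT (hw j hij le_rfl) he))
  obtain ⟨w', h, h'⟩ := exists_periodic_of_steps hT d.succ_pos h₂
  refine ⟨w', h, ?_⟩
  convert h' using 1
  push_cast
  omega

/-- A word that is not a factor of `w` has a short factor that is not a factor of `w`, provided
that long blocks determine positions in `w` up to a period. -/
theorem exists_short_forbidden {w : ℤ → A} {n : ℤ} {m : ℕ} (hw : Function.Periodic w n)
    (huniq : ∀ i j, window (m + 1) w i = window (m + 1) w j → n ∣ j - i) (u : List A)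
    (hu : ¬ IsFactor u w) :
    ∃ u' : List A, u'.length ≤ m + 2 ∧ ¬ IsFactor u' w ∧
      ∀ g : ℤ → A, IsFactor u g → IsFactor u' g := by
  induction u with
  | nil => exact absurd (isFactor_iff.2 ⟨0, fun j hj => by simp at hj⟩) hu
  | cons a u ih =>
    by_cases hu' : IsFactor u w
    -- If this prefix occurred in `w`, the `m + 1` letters after `a` would fix its position mod `n`
    -- relative to an occurrence of `u`, and `a :: u` would occur too.
    · refine ⟨(a :: u).take (m + 2), by simp, fun h => hu ?_, fun g hg => ?_⟩
      · obtain ⟨i, hi⟩ := isFactor_iff.1 hu'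
        obtain ⟨j, hj⟩ := isFactor_iff.1 h
        rcases Nat.lt_or_ge u.length (m + 1) with hl | hl
        · rw [List.take_of_length_le (by simp; omega)] at hj
          exact isFactor_iff.2 ⟨j, hj⟩
        · obtain ⟨c, hc⟩ := huniq (j + 1) i (window_eq_iff.2 fun t ht => by
            have h₁ := hi t (by omega)
            have h₂ := hj (t + 1) (by simp; omega)
            simp only [List.getElem_take, List.getElem_cons_succ] at h₂
            rw [h₁, ← h₂]
            push_cast
            rw [add_assoc, add_comm 1])
          refine isFactor_iff.2 ⟨i - 1, ?_⟩
          rintro (_ | t) ht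
          · have h₂ := hj 0 (by simp)
            simp only [List.getElem_take, List.getElem_cons_zero] at h₂ ⊢
            rw [← h₂, show i - 1 + ((0 : ℕ) : ℤ) = j + ((0 : ℕ) : ℤ) + c * n by
              rw [mul_comm, ← hc]; ring]
            exact hw.int_mul c _
          · have h₁ := hi t (by simpa using ht)
            rw [List.getElem_cons_succ, ← h₁]
            push_cast
            congr 1
            ring
      · obtain ⟨i, hi⟩ := isFactor_iff.1 hg
        exact isFactor_iff.2 ⟨i, fun t ht => by
          rw [List.getElem_take]; exact hi t (by simp at ht ⊢; omega)⟩
    · obtain ⟨u', h₁, h₂, h₃⟩ := ih hu'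
      refine ⟨u', h₁, h₂, fun g hg => h₃ g ?_⟩
      obtain ⟨i, hi⟩ := isFactor_iff.1 hg
      refine isFactor_iff.2 ⟨i + 1, fun t ht => ?_⟩
      have := hi (t + 1) (by simpa using ht)
      rw [List.getElem_cons_succ] at this
      rw [← this]
      push_cast
      congr 1
      ring

theorem exists_forbidden_of_not_avoids {T : Finset (List A)} {w : ℤ → A} (h : ¬ Avoids T w) :
    ∃ l ∈ T, ∃ i, OccursAt l w i := by
  simp only [Avoids, not_forall, not_not] at h
  obtain ⟨l, hl, h⟩ := h
  exact ⟨l, hl, isFactor_iff.1 h⟩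

open Classical in
/-- Two periodic words that violate only the two crossing restrictions at a repeated block are
glued into a word avoiding `T`. -/
theorem exists_glued {w : ℤ → A} {n : ℤ} {m : ℕ} {i j : ℤ} {T : Finset (List A)}
    (huniq : ∀ i j, window (m + 1) w i = window (m + 1) w j → n ∣ j - i)
    (hij : i < j) (hjn : j < i + n) (hv : window m w (i + 1) = window m w (j + 1))
    (hT : ∀ l ∈ T, l.length ≤ m + 2) (hw : Avoids T w)
    {f : ℤ → A} {p q : ℕ} (hp : 0 < p) (hf : Function.Periodic f (p : ℤ))
    (hfT : Avoids ((T.erase (crossingWord w m i j)).erase (crossingWord w m j i)) f)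
    {s : ℤ} (hs : OccursAt (crossingWord w m i j) f s)
    (ih : ∀ g : ℤ → A, Function.Periodic g (j - i) →
      Avoids (insert (List.ofFn (window (m + 1) w i))
        ((T.erase (crossingWord w m i j)).erase (crossingWord w m j i))) g →
      ∃ (g' : ℤ → A) (q' : ℕ), 0 < q' ∧ q' ≤ q ∧ Function.Periodic g' (q' : ℤ) ∧
        Avoids (insert (List.ofFn (window (m + 1) w i))
          ((T.erase (crossingWord w m i j)).erase (crossingWord w m j i))) g') :
    ∃ (g : ℤ → A) (r : ℕ), 0 < r ∧ r ≤ p + q ∧ Function.Periodic g (r : ℤ) ∧ Avoids T g := by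
  set T₀ := (T.erase (crossingWord w m i j)).erase (crossingWord w m j i) with hT₀
  have hsub : T₀ ⊆ T := (Finset.erase_subset _ _).trans (Finset.erase_subset _ _)
  have hne : ∀ t, i < t → t < i + n → window (m + 1) w i ≠ window (m + 1) w t :=
    fun t h₁ h₂ h => by
      have := Int.le_of_dvd (by omega) (huniq _ _ h)
      omega
  have hneb : window (m + 1) w (i + 1) ≠ window (m + 1) w (j + 1) := fun h => by
    have := Int.le_of_dvd (by omega) (huniq _ _ h)
    omega
  -- The shortcut visits only the blocks at positions `i + 1, …, j`, so it misses the one at `i`;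
  -- its closing edge is no longer forbidden in `T₀`.
  obtain ⟨c, hcT, hcp⟩ := exists_shortcut (T := insert (List.ofFn (window (m + 1) w i)) T₀) hij hv
    (by
      intro l hl
      rcases Finset.mem_insert.1 hl with rfl | hl
      · simp
      · exact hT l (hsub hl))
    (by
      intro t h₁ h₂ l hl h
      rcases Finset.mem_insert.1 hl with rfl | hl
      · exact hne t h₁ (by omega) (occursAt_ofFn_window.1 h)
      · exact hw l (hsub hl) (isFactor_iff.2 ⟨t, h⟩))
    (by
      intro h
      rcases Finset.mem_insert.1 h with h | h
      · have := congrArg List.length h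
        simp [crossingWord] at this
      · simp [hT₀] at h)
  obtain ⟨g, q', hq', hq'q, hg, hgT⟩ := ih c hcp hcT
  have hgT₀ : Avoids T₀ g := fun l hl => hgT l (Finset.mem_insert_of_mem hl)
  have hga : ∀ t, window (m + 1) g t ≠ window (m + 1) w i := fun t h =>
    hgT _ (Finset.mem_insert_self _ _) (isFactor_iff.2 ⟨t, occursAt_ofFn_window.2 h.symm⟩)
  by_cases hgT' : Avoids T g
  · exact ⟨g, q', hq', by omega, hg, hgT'⟩
  obtain ⟨l, hl, t, ht⟩ := exists_forbidden_of_not_avoids hgT'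
  have hl₁ : l ≠ crossingWord w m i j := by
    rintro rfl
    exact hga t ((occursAt_crossingWord hv).1 ht).1
  have hl₂ : l = crossingWord w m j i := by
    by_contra hl₂
    exact hgT₀ l (by simp [hT₀, hl, hl₁, hl₂]) (isFactor_iff.2 ⟨t, ht⟩)
  subst hl₂
  obtain ⟨hs₁, hs₂⟩ := (occursAt_crossingWord hv).1 hs
  obtain ⟨ht₁, ht₂⟩ := (occursAt_crossingWord hv.symm).1 ht
  have hwT₀ : Avoids T₀ w := fun l hl => hw l (hsub hl)
  obtain ⟨r, c, hr, hrpq, hc⟩ := exists_closed_steps_of_cross hp hq' (window_periodic hf)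
    (window_periodic hg) (fun t => hfT.blockStep t) (fun t => hgT₀.blockStep t) hga
    (hne j hij hjn) hneb (hwT₀.blockStep i) (hwT₀.blockStep j) hs₁ hs₂ ht₁ ht₂
  obtain ⟨g', h₁, h₂⟩ := exists_periodic_of_steps hT hr (hc.mono (s := BlockStep (m + 1) T) (by
    rintro a b ⟨⟨x, rfl, rfl, hx⟩, hab⟩
    refine ⟨x, rfl, rfl, fun l hl hlx => ?_⟩
    by_cases hl₁ : l = crossingWord w m i j
    · subst hl₁
      exact hab (Or.inl ((occursAt_crossingWord hv).1 hlx))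
    by_cases hl₂ : l = crossingWord w m j i
    · subst hl₂
      exact hab (Or.inr ((occursAt_crossingWord hv.symm).1 hlx))
    exact hx l (by simp [hT₀, hl, hl₁, hl₂]) hlx))
  exact ⟨g', r, hr, by omega, h₂, h₁⟩

end Crossing

/-! ### Growth of the Fibonacci numbers. -/

section Fibonacci

theorem fibNum_pos : ∀ k, 0 < fibNum k
  | 0 => Nat.one_pos
  | 1 => Nat.one_pos
  | k + 2 => Nat.add_pos_left (fibNum_pos (k + 1)) _

theorem fibNum_mono : Monotone fibNum := by
  refine monotone_nat_of_le_succ ?_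
  rintro (_ | k)
  · exact le_rfl
  · exact Nat.le_add_right _ _

theorem fibNum_le_goldenRatio_pow (k : ℕ) : (fibNum k : ℝ) ≤ Real.goldenRatio ^ k := by
  induction k using Nat.twoStepInduction with
  | zero => simp [fibNum]
  | one => simpa [fibNum] using Real.one_lt_goldenRatio.le
  | more k h₀ h₁ =>
    rw [fibNum, Nat.cast_add, pow_add, Real.goldenRatio_sq, mul_add, mul_one, ← pow_succ]
    exact add_le_add h₁ h₀

end Fibonacci

/-! ### The longest repeated block and the induction. -/

section ShortPeriod

variable {A : Type*}

/-- In a periodic word whose least period `n` is at least `2` there is a longest block occurring at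
two positions which are distinct modulo `n`. -/
theorem exists_longest_repeat {w : ℤ → A} {n : ℕ} (hn : 2 ≤ n) (hw : Function.Periodic w (n : ℤ))
    (hmin : ∀ p : ℕ, 0 < p → Function.Periodic w (p : ℤ) → n ≤ p) :
    ∃ (m : ℕ) (i j : ℤ), i < j ∧ j < i + n ∧ window m w (i + 1) = window m w (j + 1) ∧
      ∀ i j, window (m + 1) w i = window (m + 1) w j → (n : ℤ) ∣ j - i := by
  classical
  let P : ℕ → Prop := fun m =>
    ∃ i j : ℤ, i < j ∧ j < i + n ∧ window m w (i + 1) = window m w (j + 1)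
  have hP0 : P 0 := ⟨0, 1, by omega, by omega, funext fun x => x.elim0⟩
  have hPn : ∀ m, P m → m ≤ n := by
    rintro m ⟨i, j, hij, hjn, h⟩
    by_contra! hm
    rw [window_eq_iff] at h
    -- A repeated block longer than `n` covers every residue mod `n`, so `j - i < n` would be a
    -- period.
    have hper : Function.Periodic w ((j - i).toNat : ℤ) := fun x => by
      have hn' : (0 : ℤ) < n := by omega
      have h₁ := Int.emod_nonneg (x - (i + 1)) hn'.ne'
      have h₂ := Int.emod_lt_of_pos (x - (i + 1)) hn'
      have h₃ := h ((x - (i + 1)) % n).toNat (by omega)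
      have h₄ := Int.mul_ediv_add_emod (x - (i + 1)) n
      have e₁ : x = i + 1 + ((x - (i + 1)) % n).toNat + (x - (i + 1)) / n * n := by
        rw [Int.toNat_of_nonneg h₁]; linarith
      have e₂ : x + (j - i).toNat = j + 1 + ((x - (i + 1)) % n).toNat + (x - (i + 1)) / n * n := by
        rw [Int.toNat_of_nonneg h₁, Int.toNat_of_nonneg (by omega)]; linarith
      rw [e₂]
      refine ((hw.int_mul _ _).trans h₃.symm).trans ((hw.int_mul ((x - (i + 1)) / n) _).symm.trans ?_)
      exact congrArg w e₁.symm
    have := hmin _ (by omega) hper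
    omega
  have hspec : P (Nat.findGreatest P n) := Nat.findGreatest_spec (Nat.zero_le n) hP0
  obtain ⟨i, j, hij, hjn, h⟩ := hspec
  refine ⟨Nat.findGreatest P n, i, j, hij, hjn, h, fun i j h => ?_⟩
  by_contra hdvd
  have hn' : (0 : ℤ) < n := by omega
  have h₁ := Int.emod_nonneg (j - i) hn'.ne'
  have h₂ := Int.emod_lt_of_pos (j - i) hn'
  have h₃ : (j - i) % n ≠ 0 := fun h => hdvd (Int.dvd_of_emod_eq_zero h)
  have hP : P (Nat.findGreatest P n + 1) := by
    refine ⟨i - 1, i - 1 + (j - i) % n, by omega, by omega, ?_⟩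
    rw [sub_add_cancel, h]
    have h₄ := Int.mul_ediv_add_emod (j - i) n
    have e : j = i - 1 + (j - i) % n + 1 + (j - i) / n * n := by linarith
    conv_lhs => rw [e]
    exact (window_periodic hw).int_mul _ _
  have := Nat.le_findGreatest (hPn _ hP) hP
  omega

/-- If some periodic word avoids `T`, then so does one with period at most `fibNum T.card`. -/
theorem exists_short_period (k : ℕ) : ∀ (T : Finset (List A)), T.card = k → ∀ (w : ℤ → A) (n : ℕ),
    0 < n → Function.Periodic w (n : ℤ) → Avoids T w →
    ∃ (w' : ℤ → A) (p : ℕ), 0 < p ∧ p ≤ fibNum k ∧ Function.Periodic w' (p : ℤ) ∧ Avoids T w' := by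
  classical
  induction k using Nat.strong_induction_on with
  | _ k ih =>
  intro T hTk w₀ n₀ hn₀ hw₀ hTw₀
  -- The minimum is over all periodic words avoiding `T`, since a shortcut is in general a different
  -- word.
  have hex : ∃ n : ℕ, 0 < n ∧ ∃ w : ℤ → A, Function.Periodic w (n : ℤ) ∧ Avoids T w :=
    ⟨n₀, hn₀, w₀, hw₀, hTw₀⟩
  obtain ⟨hn, w, hw, hTw⟩ := Nat.find_spec hex
  have hmin : ∀ (p : ℕ) (g : ℤ → A), 0 < p → Function.Periodic g (p : ℤ) → Avoids T g →
      Nat.find hex ≤ p := fun p g hp hg hTg => Nat.find_le ⟨hp, g, hg, hTg⟩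
  generalize Nat.find hex = n at hn hw hmin
  rcases Nat.lt_or_ge n 2 with hn2 | hn2
  · exact ⟨w, n, hn, (Nat.le_of_lt_succ hn2).trans (fibNum_pos k), hw, hTw⟩
  obtain ⟨m, i, j, hij, hjn, hv, huniq⟩ := exists_longest_repeat hn2 hw
    fun p hp hpw => hmin p w hp hpw hTw
  obtain ⟨F, hF⟩ : ∃ F : List A → List A, ∀ u ∈ T, (F u).length ≤ m + 2 ∧ ¬ IsFactor (F u) w ∧
      ∀ g : ℤ → A, IsFactor u g → IsFactor (F u) g := by
    choose! F hF using fun u (hu : u ∈ T) => exists_short_forbidden hw huniq u (hTw u hu)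
    exact ⟨F, hF⟩
  obtain ⟨S, hS⟩ : ∃ S, S = T.image F := ⟨_, rfl⟩
  have hSk : S.card ≤ k := hS ▸ hTk ▸ Finset.card_image_le
  have hST : ∀ g : ℤ → A, Avoids S g → Avoids T g := fun g hg u hu h =>
    hg (F u) (hS ▸ Finset.mem_image_of_mem F hu) ((hF u hu).2.2 g h)
  have hSlen : ∀ l ∈ S, l.length ≤ m + 2 := by
    rw [hS]
    simpa using fun u hu => (hF u hu).1
  have hSw : Avoids S w := by
    rw [hS]
    intro l hl
    obtain ⟨u, hu, rfl⟩ := Finset.mem_image.1 hl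
    exact (hF u hu).2.1
  have hSocc : ∀ t, ∀ l ∈ S, ¬ OccursAt l w t := fun t l hl h =>
    hSw l hl (isFactor_iff.2 ⟨t, h⟩)
  have hcut : ∀ i j : ℤ, i < j → j < i + n → window m w (i + 1) = window m w (j + 1) →
      crossingWord w m j i ∈ S := by
    intro i j hij hjn hv
    by_contra he
    obtain ⟨g, hSg, hg⟩ := exists_shortcut hij hv hSlen (fun t _ _ => hSocc t) he
    have := hmin (j - i).toNat g (by omega) (by rwa [Int.toNat_of_nonneg (by omega)]) (hST g hSg)
    omega
  have hv' : window m w (j + 1) = window m w (i + n + 1) := by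
    rw [add_right_comm, window_periodic hw, hv]
  have he₂ := hcut i j hij hjn hv
  -- The other crossing edge cuts out the complementary arc of the cycle, from `j` to `i + n`.
  have he₁ := hcut j (i + n) hjn (by omega) hv'
  rw [crossingWord_add_left hw] at he₁
  have hne : crossingWord w m i j ≠ crossingWord w m j i := fun h => by
    have h₁ := (occursAt_crossingWord (t := 0) hv).1 (occursAt_ofFn_window.2 rfl)
    have h₂ := (occursAt_crossingWord (t := 0) hv.symm).1 (by
      rw [← h]; exact occursAt_ofFn_window.2 rfl)
    have := Int.le_of_dvd (by omega) (huniq _ _ (h₁.1.symm.trans h₂.1))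
    omega
  have hcard : ((S.erase (crossingWord w m i j)).erase (crossingWord w m j i)).card + 2 = S.card := by
    have h₁ := Finset.card_erase_add_one he₁
    have h₂ := Finset.card_erase_add_one (Finset.mem_erase.2 ⟨hne.symm, he₂⟩)
    omega
  obtain ⟨f, p, hp, hpk, hf, hfS⟩ := ih _ (by omega)
    ((S.erase (crossingWord w m i j)).erase (crossingWord w m j i)) rfl w n hn hw
    fun l hl => hSw l (Finset.mem_of_mem_erase (Finset.mem_of_mem_erase hl))
  obtain ⟨c, hc⟩ : ∃ c, c = ((S.erase (crossingWord w m i j)).erase (crossingWord w m j i)).card :=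
    ⟨_, rfl⟩
  rw [← hc] at hpk hcard
  have hfib : fibNum (c + 1) + fibNum c ≤ fibNum k :=
    fibNum_mono (show c + 2 ≤ k by omega)
  by_cases hfS' : Avoids S f
  · exact ⟨f, p, hp, by omega, hf, hST f hfS'⟩
  have ih' : ∀ (x : List A) (d : ℤ) (g : ℤ → A), 0 < d → Function.Periodic g d →
      Avoids (insert x ((S.erase (crossingWord w m i j)).erase (crossingWord w m j i))) g →
      ∃ (g' : ℤ → A) (q' : ℕ), 0 < q' ∧ q' ≤ fibNum (c + 1) ∧ Function.Periodic g' (q' : ℤ) ∧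
        Avoids (insert x ((S.erase (crossingWord w m i j)).erase (crossingWord w m j i))) g' := by
    intro x d g hd hg hgS
    have hx := Finset.card_insert_le x
      ((S.erase (crossingWord w m i j)).erase (crossingWord w m j i))
    obtain ⟨g', q', h₁, h₂, h₃⟩ := ih _ (by omega) _ rfl g d.toNat (by omega)
      (by rwa [Int.toNat_of_nonneg hd.le]) hgS
    exact ⟨g', q', h₁, h₂.trans (fibNum_mono (by omega)), h₃⟩
  obtain ⟨g, r, hr, hrpq, hg, hgS⟩ : ∃ (g : ℤ → A) (r : ℕ), 0 < r ∧ r ≤ p + fibNum (c + 1) ∧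
      Function.Periodic g (r : ℤ) ∧ Avoids S g := by
    obtain ⟨l, hl, s, hs⟩ := exists_forbidden_of_not_avoids hfS'
    by_cases hl₁ : l = crossingWord w m i j
    · subst hl₁
      exact exists_glued huniq hij hjn hv hSlen hSw hp hf hfS hs
        fun g hg hgS => ih' _ _ g (by omega) hg hgS
    by_cases hl₂ : l = crossingWord w m j i
    · subst hl₂
      -- Passing from `(i, j)` to `(j, i + n)` swaps the two crossing words, so this case is the
      -- previous one with the roles exchanged.
      have e : (S.erase (crossingWord w m j (i + n))).erase (crossingWord w m (i + n) j) =
          (S.erase (crossingWord w m i j)).erase (crossingWord w m j i) := by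
        rw [crossingWord_add_left hw, crossingWord_add_right hw, Finset.erase_right_comm]
      refine exists_glued huniq hjn (by omega) hv' hSlen hSw hp hf (e ▸ hfS)
        (by rwa [crossingWord_add_right hw]) fun g hg hgS => ?_
      rw [e] at hgS ⊢
      exact ih' _ _ g (by omega) hg hgS
    · exact absurd (isFactor_iff.2 ⟨s, hs⟩) (hfS l (by simp [hl, hl₁, hl₂]))
  exact ⟨g, r, hr, by omega, hg, hST g hgS⟩

end ShortPeriod

theorem mainTheorem1 {A : Type*} [Finite A] (w : ℤ → A) (n k : ℕ) (S : Finset (List A))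
    (hw : HasLeastPeriod w n) (hS : Determines S w) (hk : S.card = k) :
    n ≤ fibNum k ∧ (n : ℝ) ≤ Real.goldenRatio ^ k := by
  obtain ⟨w', p, hp, hpk, hw', hSw'⟩ := exists_short_period k S hk w n hw.1.1 hw.1.2 hS.1
  obtain ⟨c, hc⟩ := hS.2 w' hSw'
  have hper : Function.Periodic w (p : ℤ) := fun t => by
    have h₁ := hc (t - c + p)
    rw [hw' (t - c), hc, show t - c + p + c = t + p by ring, sub_add_cancel] at h₁
    exact h₁.symm
  have hn : n ≤ fibNum k := (hw.2 ⟨hp, hper⟩).trans hpk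
  exact ⟨hn, (Nat.cast_le.2 hn).trans (fibNum_le_goldenRatio_pow k)⟩
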